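/- Let $(X,d_X)$ be a locally compact, separable metric space and let $\mu$ be a Borel regular measure on $X$ such that $0<\mu(B(x,r))<\infty$ for every $x\in X$ and $r>0$. Let $\mathcal{M}$ be the set of all finite Borel measures $\nu$ on $X$ with compact support and $0\le \nu\le\mu$, and write $\|\nu\|=\nu(X)$. Fix a strictly increasing continuous function $h:[0,\infty)\to[0,\infty)$ with $h(0)=\lim_{\varepsilon\to0^+}h(\varepsilon)/\varepsilon=0$, with $h(\varepsilon_1)+h(\varepsilon_2)\le h(\varepsilon_1+\varepsilon_2)$ for all $\varepsilon_1,\varepsilon_2\ge 0$, and with $\lim_{\varepsilon\to\infty}h(\varepsilon)=\infty$. For $\nu,\eta\in\mathcal{M}$ let $d_{\mathcal{M}}(\nu,\eta)$ be the infimum of all $\varepsilon>0$ for which there are an at most countable family $(\nu_i,\eta_i)_{i\in I}$ of pairs of elements of $\mathcal{M}$ such that $\nu=\sum_i\nu_i$, $\eta=\sum_i\eta_i$, $\sum_i\bigl|\|\nu_i\|-\|\eta_i\|\bigr|\le h(\varepsilon)$, and $\operatorname{diam}(\operatorname{supp}\nu_i\cup\operatorname{supp}\eta_i)\le\varepsilon$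 for every $i$. For $A\subset X$ and $\varepsilon\ge0$ let $A_\varepsilon=\{y\in X:\operatorname{dist}(y,A)\le\varepsilon\}$ (so $\emptyset_\varepsilon=\emptyset$). Let $b\ge 0$ and let $\eta:[0,b]\to\mathcal{M}$ be $1$-Lipschitz, i.e. $d_{\mathcal{M}}(\eta(t),\eta(s))\le t-s$ whenever $0\le s\le t\le b$. Then: 1. $\|\eta(t)\|$ is constant on $[0,b]$. 2. If $s,t\in[0,b]$ and $|s-t|<\varepsilon$, then $\operatorname{supp}\eta(t)\subset(\operatorname{supp}\eta(s))_\varepsilon$. 3. The set $\bigcup_{s\in[0,b]}\operatorname{supp}\eta(s)$ is compact. -/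

import Mathlib

open Set Filter Topology MeasureTheory
open scoped NNReal ENNReal

/-- The standing assumption on the measure of the metric measure space: every ball (of positive
radius) has positive and finite measure.  (A Mathlib measure on a Borel space is automatically
Borel regular, since its value on an arbitrary set is the infimum over measurable supersets.) -/
def PosFiniteOnBalls {X : Type*} [MetricSpace X] [MeasurableSpace X] (μ : Measure X) : Prop :=
  ∀ (x : X) (r : ℝ), 0 < r → 0 < μ (Metric.ball x r) ∧ μ (Metric.ball x r) < ∞

/-- The admissible functions `h : [0, ∞) → [0, ∞)`. -/
structure IsMassGauge (h : ℝ≥0 → ℝ≥0) : Prop where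
  strictMono : StrictMono h
  continuous : Continuous h
  map_zero : h 0 = 0
  tendsto_div_zero : Tendsto (fun ε : ℝ≥0 => h ε / ε) (𝓝[>] 0) (𝓝 0)
  superadditive : ∀ ε₁ ε₂ : ℝ≥0, h ε₁ + h ε₂ ≤ h (ε₁ + ε₂)
  tendsto_atTop : Tendsto h atTop atTop

/-- `𝓟`: finite Borel measures with compact support. -/
def compactMeasures (X : Type*) [MetricSpace X] [MeasurableSpace X] : Set (Measure X) :=
  {ν | IsFiniteMeasure ν ∧ IsCompact ν.support}

/-- `𝓜 = {ν ∈ 𝓟 : 0 ≤ ν ≤ μ}`. -/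
def subMeasures {X : Type*} [MetricSpace X] [MeasurableSpace X] (μ : Measure X) :
    Set (Measure X) :=
  {ν | ν ∈ compactMeasures X ∧ ν ≤ μ}

/-- The total mass `‖ν‖` of a (finite) measure. -/
noncomputable def totalMass {X : Type*} [MeasurableSpace X] (ν : Measure X) : ℝ :=
  ν.real univ

/-- `(νᵢ, ηᵢ)_{i ∈ ι}` belongs to `Γ_{ε,δ}(ν, η)`. -/
structure IsDecomposition {X : Type*} [MetricSpace X] [MeasurableSpace X] (μ : Measure X)
    (ε δ : ℝ≥0) (ν η : Measure X) {ι : Type} (νs ηs : ι → Measure X) : Prop where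
  countable : Countable ι
  left_mem : ∀ i, νs i ∈ subMeasures μ
  right_mem : ∀ i, ηs i ∈ subMeasures μ
  left_sum : ν = Measure.sum νs
  right_sum : η = Measure.sum ηs
  mass_diff : ∑' i, ENNReal.ofReal |totalMass (νs i) - totalMass (ηs i)| ≤ (δ : ℝ≥0∞)
  diam_le : ∀ i, Metric.ediam ((νs i).support ∪ (ηs i).support) ≤ (ε : ℝ≥0∞)

/-- `d_𝓜(ν, η) = inf {ε > 0 : Γ_{ε,h(ε)}(ν, η) ≠ ∅}`. -/
noncomputable def massDist {X : Type*} [MetricSpace X] [MeasurableSpace X] (μ : Measure X)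
    (h : ℝ≥0 → ℝ≥0) (ν η : Measure X) : ℝ≥0 :=
  sInf {ε : ℝ≥0 | 0 < ε ∧
    ∃ (ι : Type) (νs ηs : ι → Measure X), IsDecomposition μ ε (h ε) ν η νs ηs}

/-- A map `η : [0, b] → 𝓜` is a curve subparametrized by arc-length if it is 1-Lipschitz for
`d_𝓜`.  (Its length is then at most `b`, so it is rectifiable.) -/
def IsSubArcLengthCurve {X : Type*} [MetricSpace X] [MeasurableSpace X] (μ : Measure X)
    (h : ℝ≥0 → ℝ≥0) {b : ℝ} (η : Icc (0 : ℝ) b → subMeasures μ) : Prop :=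
  ∀ s t : Icc (0 : ℝ) b, s ≤ t →
    (massDist μ h (η t : Measure X) (η s : Measure X) : ℝ) ≤ (t : ℝ) - (s : ℝ)

/-!
Call `ν` and `η` one-sidedly `(ε, δ)`-close if `ν B ≤ η (B_ε) + δ` for every set `B`. A
decomposition in `Γ_{ε,δ}(ν, η)` makes `ν` and `η` `(ε, δ)`-close, since a piece of `ν` that
charges `B` is matched with a piece of `η` lying within `ε` of `B`, up to the mass difference.
Cutting `[s, t]` into `n` equal pieces and composing the `n` resulting inequalities yields
closeness with parameters `ε` and `n h(ε / n)`; as `h(ε) = o(ε)`, the mass error vanishes when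
`n → ∞`. Hence `η(t)(B) ≤ η(s)(B_ε)` for all `ε > |t - s|`: with `B = X` this gives the constancy of
the mass, and with `B` a small ball around a point of `supp η(t)` the inclusion of supports. The
supports thus form an upper hemicontinuous family of compact sets over a compact interval, so
their union is compact.
-/

theorem isCompact_biUnion_of_upperHemicontinuousOn {T X : Type*} [TopologicalSpace T]
    [TopologicalSpace X] {S : Set T} {K : T → Set X} (hS : IsCompact S)
    (hK : ∀ t ∈ S, IsCompact (K t)) (hupper : UpperHemicontinuousOn K S) :
    IsCompact (⋃ t ∈ S, K t) := by
  refine isCompact_of_finite_subcover fun {ι} U hU hcover => ?_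
  let Covered (A : Set T) : Prop := ∃ F : Finset ι, ⋃ t ∈ A, K t ⊆ ⋃ i ∈ F, U i
  have covered_mono {A B : Set T} (hAB : A ⊆ B) : Covered B → Covered A := fun ⟨F, hF⟩ =>
    ⟨F, (biUnion_mono hAB fun _ _ => Subset.rfl).trans hF⟩
  have covered_union {A B : Set T} : Covered A → Covered B → Covered (A ∪ B) := by
    classical
    rintro ⟨F, hF⟩ ⟨G, hG⟩
    refine ⟨F ∪ G, ?_⟩
    rw [biUnion_union, Finset.set_biUnion_union]
    exact union_subset_union hF hG
  refine hS.induction_on (p := Covered) ⟨∅, by simp⟩ (fun _ _ => covered_mono)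
    (fun _ _ => covered_union) fun t ht => ?_
  obtain ⟨F, hF⟩ := (hK t ht).elim_finite_subcover U hU ((subset_biUnion_of_mem ht).trans hcover)
  have hnear : ∀ᶠ t' in 𝓝[S] t, K t' ⊆ ⋃ i ∈ F, U i :=
    hupper.forall_isOpen t ht _ (isOpen_biUnion fun i _ => hU i) hF
  exact ⟨_, hnear, F, iUnion₂_subset fun _ h => h⟩

theorem upperHemicontinuous_of_subset_cthickening {T X : Type*} [PseudoMetricSpace T]
    [PseudoEMetricSpace X] {K : T → Set X} (hK : ∀ t, IsCompact (K t))
    (hsub : ∀ (s t : T) (ε : ℝ), dist s t < ε → K t ⊆ Metric.cthickening ε (K s)) :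
    UpperHemicontinuous K := by
  refine upperHemicontinuous_iff_forall_isOpen.2 fun s U hU hsU => ?_
  obtain ⟨ε, hε, hεU⟩ := (hK s).exists_cthickening_subset_open hU hsU
  filter_upwards [Metric.ball_mem_nhds s hε] with t ht
  exact (hsub s t ε (Metric.mem_ball'.1 ht)).trans hεU

theorem exists_equidistant_chain_of_convex {E : Type*} [SeminormedAddCommGroup E] [NormedSpace ℝ E]
    {S : Set E} (hS : Convex ℝ S) (s t : S) {n : ℕ} (hn : n ≠ 0) :
    ∃ p : ℕ → S, p 0 = s ∧ p n = t ∧ ∀ k < n, dist (p k) (p (k + 1)) = dist s t / n := by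
  have hn' : (0 : ℝ) < n := by positivity
  have hmem (k : ℕ) : AffineMap.lineMap (s : E) (t : E) (min ((k : ℝ) / n) 1) ∈ S :=
    hS.lineMap_mem s.2 t.2 ⟨by positivity, min_le_right _ _⟩
  refine ⟨fun k => ⟨_, hmem k⟩, by simp, by simp [hn], fun k hk => ?_⟩
  have hk₀ : (k : ℝ) / n ≤ 1 := (div_le_one hn').2 (by exact_mod_cast hk.le)
  have hk₁ : ((k + 1 : ℕ) : ℝ) / n ≤ 1 := (div_le_one hn').2 (by exact_mod_cast hk)
  have hgap : dist ((k : ℝ) / n) ((k + 1 : ℕ) / n) = 1 / n := by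
    rw [Real.dist_eq, ← sub_div, abs_div, abs_of_pos hn', Nat.cast_succ, sub_add_cancel_left,
      abs_neg, abs_one]
  simp only [Subtype.dist_eq, min_eq_left hk₀, min_eq_left hk₁, dist_lineMap_lineMap, hgap,
    one_div_mul_eq_div]

theorem tendsto_natCast_mul_comp_div {h : ℝ≥0 → ℝ≥0}
    (hdiv : Tendsto (fun ε => h ε / ε) (𝓝[>] 0) (𝓝 0)) {ε : ℝ≥0} (hε : 0 < ε) :
    Tendsto (fun n : ℕ => n * h (ε / n)) atTop (𝓝 0) := by
  have hstep : Tendsto (fun n : ℕ => ε / (n : ℝ≥0)) atTop (𝓝[>] 0) := by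
    refine tendsto_nhdsWithin_iff.2 ⟨tendsto_const_div_atTop_nhds_zero_nat ε, ?_⟩
    filter_upwards [eventually_gt_atTop 0] with n hn
    exact div_pos hε (Nat.cast_pos.2 hn)
  have hmul := (hdiv.comp hstep).const_mul ε
  rw [mul_zero] at hmul
  refine hmul.congr' ?_
  filter_upwards [eventually_ne_atTop 0] with n hn
  simp only [Function.comp_apply]
  field_simp

/-- One-sided Lévy–Prokhorov closeness of `ν` to `η`, with separate tolerances `ε` for the position
and `δ` for the mass. All sets `B` are tested, measurable or not, and `B` is enlarged to its closed
`ε`-neighbourhood. -/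
def ProkhorovLE {X : Type*} [PseudoEMetricSpace X] [MeasurableSpace X] (ε : ℝ≥0) (δ : ℝ≥0∞)
    (ν η : Measure X) : Prop :=
  ∀ B : Set X, ν B ≤ η (Metric.cthickening ε B) + δ

namespace ProkhorovLE

section PseudoEMetricSpace

variable {X : Type*} [PseudoEMetricSpace X] [MeasurableSpace X] {ε ε' : ℝ≥0} {δ δ' : ℝ≥0∞}
  {ν η ρ : Measure X}

theorem refl (ε : ℝ≥0) (δ : ℝ≥0∞) (ν : Measure X) : ProkhorovLE ε δ ν ν := fun B =>
  (measure_mono (Metric.self_subset_cthickening B)).trans le_self_add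

theorem mono (hνη : ProkhorovLE ε δ ν η) (hε : ε ≤ ε') (hδ : δ ≤ δ') : ProkhorovLE ε' δ' ν η :=
  fun B => (hνη B).trans
    (add_le_add (measure_mono (Metric.cthickening_mono (NNReal.coe_le_coe.2 hε) B)) hδ)

theorem trans (hνη : ProkhorovLE ε δ ν η) (hηρ : ProkhorovLE ε' δ' η ρ) :
    ProkhorovLE (ε + ε') (δ + δ') ν ρ := fun B => by
  have hthick : Metric.cthickening ε' (Metric.cthickening ε B) ⊆
      Metric.cthickening ↑(ε + ε') B := by
    rw [NNReal.coe_add, add_comm]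
    exact Metric.cthickening_cthickening_subset ε'.2 ε.2 B
  calc ν B ≤ η (Metric.cthickening ε B) + δ := hνη B
    _ ≤ ρ (Metric.cthickening ε' (Metric.cthickening ε B)) + δ' + δ := by gcongr; exact hηρ _
    _ ≤ ρ (Metric.cthickening ↑(ε + ε') B) + δ' + δ := by gcongr
    _ = ρ (Metric.cthickening ↑(ε + ε') B) + (δ + δ') := by rw [add_assoc, add_comm δ']

theorem chain {ν : ℕ → Measure X} {n : ℕ} (hν : ∀ k < n, ProkhorovLE ε δ (ν k) (ν (k + 1))) :
    ProkhorovLE (n * ε) (n * δ) (ν 0) (ν n) := by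
  induction n with
  | zero => exact refl _ _ _
  | succ n ih =>
    simpa only [Nat.cast_succ, add_one_mul] using
      (ih fun k hk => hν k (hk.trans n.lt_succ_self)).trans (hν n n.lt_succ_self)

theorem sum {ι : Type*} [Countable ι] {νs ηs : ι → Measure X} {δs : ι → ℝ≥0∞}
    (hνη : ∀ i, ProkhorovLE ε (δs i) (νs i) (ηs i)) :
    ProkhorovLE ε (∑' i, δs i) (Measure.sum νs) (Measure.sum ηs) := fun B => by
  rw [Measure.sum_apply_of_countable, Measure.sum_apply_of_countable, ← ENNReal.tsum_add]
  exact ENNReal.tsum_le_tsum fun i => hνη i B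

theorem of_tendsto {ι : Type*} {l : Filter ι} [l.NeBot] {δs : ι → ℝ≥0∞}
    (hδs : Tendsto δs l (𝓝 δ)) (hνη : ∀ᶠ i in l, ProkhorovLE ε (δs i) ν η) :
    ProkhorovLE ε δ ν η := fun B =>
  ge_of_tendsto (tendsto_const_nhds.add hδs) (hνη.mono fun _ hi => hi B)

theorem measure_univ_le (hνη : ProkhorovLE ε δ ν η) : ν univ ≤ η univ + δ :=
  (hνη univ).trans (by gcongr; exact subset_univ _)

theorem of_edist_support_le [HereditarilyLindelofSpace X]
    (hdist : ∀ x ∈ ν.support, ∀ y ∈ η.support, edist x y ≤ ε) (hmass : ν univ ≤ η univ + δ) :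
    ProkhorovLE ε δ ν η := fun B => by
  rcases eq_or_ne (ν B) 0 with hB | hB
  · simp [hB]
  obtain ⟨x, hxB, hxν⟩ := Measure.nonempty_inter_support_of_pos (pos_iff_ne_zero.2 hB)
  have hsupport : η.support ⊆ Metric.cthickening ε B := fun y hy =>
    Metric.mem_cthickening_of_edist_le y x ε B hxB <| by
      simpa only [edist_comm y, ENNReal.ofReal_coe_nnreal] using hdist x hxν y hy
  have hfull : η univ ≤ η (Metric.cthickening ε B) :=
    measure_mono_ae (mem_of_superset Measure.support_mem_ae fun y hy _ => hsupport hy)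
  calc ν B ≤ ν univ := measure_mono (subset_univ B)
    _ ≤ η univ + δ := hmass
    _ ≤ η (Metric.cthickening ε B) + δ := by gcongr

theorem of_convex_of_tendsto_div {E : Type*} [SeminormedAddCommGroup E] [NormedSpace ℝ E]
    {S : Set E} (hS : Convex ℝ S) {h : ℝ≥0 → ℝ≥0}
    (hdiv : Tendsto (fun ε => h ε / ε) (𝓝[>] 0) (𝓝 0)) {η : S → Measure X}
    (hη : ∀ (s t : S) (ε : ℝ≥0), dist s t < ε → ProkhorovLE ε (h ε) (η s) (η t))
    {s t : S} (hst : dist s t < ε) : ProkhorovLE ε 0 (η s) (η t) := by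
  have hε : 0 < ε := NNReal.coe_pos.1 (dist_nonneg.trans_lt hst)
  have hlim : Tendsto (fun n : ℕ => ((n * h (ε / n) : ℝ≥0) : ℝ≥0∞)) atTop (𝓝 0) :=
    ENNReal.tendsto_coe.2 (tendsto_natCast_mul_comp_div hdiv hε)
  refine of_tendsto hlim ?_
  filter_upwards [eventually_ne_atTop 0] with n hn
  obtain ⟨p, rfl, rfl, hp⟩ := exists_equidistant_chain_of_convex hS s t hn
  have hstep (k : ℕ) (hk : k < n) :
      ProkhorovLE (ε / n) (h (ε / n)) (η (p k)) (η (p (k + 1))) := by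
    refine hη _ _ _ ?_
    rw [hp k hk, NNReal.coe_div, NNReal.coe_natCast]
    gcongr
  simpa [mul_div_cancel₀ ε (Nat.cast_ne_zero.2 hn)] using chain (ν := fun k => η (p k)) hstep

end PseudoEMetricSpace

theorem support_subset_cthickening {X : Type*} [PseudoMetricSpace X] [HereditarilyLindelofSpace X]
    [MeasurableSpace X] {ε : ℝ≥0} {ν η : Measure X} (hνη : ProkhorovLE ε 0 ν η) :
    ν.support ⊆ Metric.cthickening ε η.support := fun x hx => by
  rw [Metric.cthickening_eq_iInter_cthickening]
  refine mem_iInter₂.2 fun r hr => ?_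
  have hr₀ : 0 < r - ε := sub_pos.2 hr
  have hpos : 0 < η (Metric.cthickening ε (Metric.ball x (r - ε))) := by
    simpa only [add_zero] using ((Measure.mem_support_iff_forall x).1 hx _
      (Metric.ball_mem_nhds x hr₀)).trans_le (hνη _)
  obtain ⟨z, hz, hzη⟩ := Measure.nonempty_inter_support_of_pos hpos
  have hzx : z ∈ Metric.cthickening r {x} := by
    rw [← add_sub_cancel (ε : ℝ) r]
    refine Metric.cthickening_cthickening_subset ε.2 hr₀.le _
      (Metric.cthickening_subset_of_subset _ ?_ hz)
    exact Metric.ball_subset_closedBall.trans (Metric.closedBall_subset_cthickening_singleton x _)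
  rw [Metric.cthickening_singleton x (ε.2.trans hr.le), Metric.mem_closedBall'] at hzx
  exact Metric.mem_cthickening_of_dist_le x z r _ hzη hzx

end ProkhorovLE

theorem measure_univ_le_add_ofReal_abs_totalMass_sub {X : Type*} [MeasurableSpace X]
    (ν η : Measure X) [IsFiniteMeasure ν] [IsFiniteMeasure η] :
    ν univ ≤ η univ + ENNReal.ofReal |totalMass ν - totalMass η| := by
  rw [← ofReal_measureReal, ← ofReal_measureReal (μ := η),
    ← ENNReal.ofReal_add measureReal_nonneg (abs_nonneg _)]
  exact ENNReal.ofReal_le_ofReal (sub_le_iff_le_add'.1 (le_abs_self _))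

section massDist

variable {X : Type*} [MetricSpace X] [MeasurableSpace X] {μ ν η : Measure X}

namespace IsDecomposition

variable {ε δ : ℝ≥0} {ι : Type} {νs ηs : ι → Measure X}

theorem symm (hdec : IsDecomposition μ ε δ ν η νs ηs) : IsDecomposition μ ε δ η ν ηs νs where
  countable := hdec.countable
  left_mem := hdec.right_mem
  right_mem := hdec.left_mem
  left_sum := hdec.right_sum
  right_sum := hdec.left_sum
  mass_diff := by simpa only [abs_sub_comm] using hdec.mass_diff
  diam_le i := by simpa only [union_comm] using hdec.diam_le i

theorem single (hν : ν ∈ subMeasures μ) (hη : η ∈ subMeasures μ)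
    (hmass : |totalMass ν - totalMass η| ≤ δ) (hdiam : Metric.ediam (ν.support ∪ η.support) ≤ ε) :
    IsDecomposition μ ε δ ν η (fun _ : Unit => ν) (fun _ => η) where
  countable := inferInstance
  left_mem _ := hν
  right_mem _ := hη
  left_sum := by simp
  right_sum := by simp
  mass_diff := by simpa using hmass
  diam_le _ := hdiam

theorem prokhorovLE [HereditarilyLindelofSpace X] (hdec : IsDecomposition μ ε δ ν η νs ηs) :
    ProkhorovLE ε δ ν η := by
  have := hdec.countable
  rw [hdec.left_sum, hdec.right_sum]
  refine (ProkhorovLE.sum fun i => ?_).mono le_rfl hdec.mass_diff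
  have := (hdec.left_mem i).1.1
  have := (hdec.right_mem i).1.1
  refine .of_edist_support_le (fun x hx y hy => ?_)
    (measure_univ_le_add_ofReal_abs_totalMass_sub _ _)
  exact (Metric.edist_le_ediam_of_mem (.inl hx) (.inr hy)).trans (hdec.diam_le i)

end IsDecomposition

variable {h : ℝ≥0 → ℝ≥0}

theorem massDist_comm (μ : Measure X) (h : ℝ≥0 → ℝ≥0) (ν η : Measure X) :
    massDist μ h ν η = massDist μ h η ν := by
  have hsymm (ε : ℝ≥0) : (∃ (ι : Type) (νs ηs : ι → Measure X),
      IsDecomposition μ ε (h ε) ν η νs ηs) ↔ ∃ (ι : Type) (νs ηs : ι → Measure X),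
      IsDecomposition μ ε (h ε) η ν νs ηs :=
    ⟨fun ⟨ι, νs, ηs, hdec⟩ => ⟨ι, ηs, νs, hdec.symm⟩,
      fun ⟨ι, νs, ηs, hdec⟩ => ⟨ι, ηs, νs, hdec.symm⟩⟩
  simp only [massDist, hsymm]

theorem exists_isDecomposition (htop : Tendsto h atTop atTop) (hν : ν ∈ subMeasures μ)
    (hη : η ∈ subMeasures μ) :
    ∃ ε : ℝ≥0, 0 < ε ∧
      ∃ (ι : Type) (νs ηs : ι → Measure X), IsDecomposition μ ε (h ε) ν η νs ηs := by
  obtain ⟨D, hD⟩ := WithTop.ne_top_iff_exists.1 (hν.1.2.union hη.1.2).isBounded.ediam_ne_top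
  obtain ⟨ε, hε, hdiam, hmass⟩ := ((eventually_gt_atTop (0 : ℝ≥0)).and
    ((eventually_ge_atTop D).and
    (htop.eventually_ge_atTop |totalMass ν - totalMass η|.toNNReal))).exists
  exact ⟨ε, hε, Unit, _, _, .single hν hη (Real.toNNReal_le_iff_le_coe.1 hmass)
    (hD ▸ ENNReal.coe_le_coe.2 hdiam)⟩

theorem prokhorovLE_of_massDist_lt [HereditarilyLindelofSpace X] (hmono : Monotone h)
    (htop : Tendsto h atTop atTop) (hν : ν ∈ subMeasures μ) (hη : η ∈ subMeasures μ) {ε : ℝ≥0}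
    (hε : massDist μ h ν η < ε) : ProkhorovLE ε (h ε) ν η := by
  obtain ⟨ε', ⟨-, ι, νs, ηs, hdec⟩, hlt⟩ :=
    exists_lt_of_csInf_lt (exists_isDecomposition htop hν hη) hε
  exact hdec.prokhorovLE.mono hlt.le (ENNReal.coe_le_coe.2 (hmono hlt.le))

end massDist

namespace IsSubArcLengthCurve

variable {X : Type*} [MetricSpace X] [MeasurableSpace X] {μ : Measure X} {h : ℝ≥0 → ℝ≥0} {b : ℝ}
  {η : Icc (0 : ℝ) b → subMeasures μ}

theorem massDist_le_dist (hη : IsSubArcLengthCurve μ h η) (s t : Icc (0 : ℝ) b) :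
    (massDist μ h (η s) (η t) : ℝ) ≤ dist s t := by
  rw [Subtype.dist_eq, Real.dist_eq]
  rcases le_total s t with hst | hts
  · rw [massDist_comm, abs_sub_comm]
    exact (hη s t hst).trans (le_abs_self _)
  · exact (hη t s hts).trans (le_abs_self _)

theorem prokhorovLE_zero [HereditarilyLindelofSpace X] (hη : IsSubArcLengthCurve μ h η)
    (hmono : Monotone h) (hdiv : Tendsto (fun ε => h ε / ε) (𝓝[>] 0) (𝓝 0))
    (htop : Tendsto h atTop atTop) {s t : Icc (0 : ℝ) b} {ε : ℝ≥0} (hst : dist s t < ε) :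
    ProkhorovLE ε 0 (η s : Measure X) (η t) :=
  .of_convex_of_tendsto_div (convex_Icc 0 b) hdiv (η := fun s => (η s : Measure X))
    (fun s t _ hε => prokhorovLE_of_massDist_lt hmono htop (η s).2 (η t).2
      (NNReal.coe_lt_coe.1 ((hη.massDist_le_dist s t).trans_lt hε))) hst

end IsSubArcLengthCurve

theorem mainTheorem9_general {X : Type*} [MetricSpace X] [TopologicalSpace.SeparableSpace X]
    [MeasurableSpace X] (μ : Measure X) {h : ℝ≥0 → ℝ≥0} (hmono : Monotone h)
    (hdiv : Tendsto (fun ε => h ε / ε) (𝓝[>] 0) (𝓝 0)) (htop : Tendsto h atTop atTop)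
    {b : ℝ} (η : Icc (0 : ℝ) b → subMeasures μ) (hη : IsSubArcLengthCurve μ h η) :
    (∀ s t : Icc (0 : ℝ) b, totalMass (η s : Measure X) = totalMass (η t : Measure X)) ∧
    (∀ (s t : Icc (0 : ℝ) b) (ε : ℝ), |(s : ℝ) - (t : ℝ)| < ε →
      (η t : Measure X).support ⊆ Metric.cthickening ε (η s : Measure X).support) ∧
    IsCompact (⋃ s : Icc (0 : ℝ) b, (η s : Measure X).support) := by
  have := UniformSpace.secondCountable_of_separable X
  have hmass (s t : Icc (0 : ℝ) b) : (η s : Measure X) univ ≤ (η t : Measure X) univ := by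
    have hdist : dist s t < (nndist s t + 1 : ℝ≥0) := lt_add_one _
    simpa only [add_zero] using (hη.prokhorovLE_zero hmono hdiv htop hdist).measure_univ_le
  have hsupport (s t : Icc (0 : ℝ) b) (ε : ℝ) (hst : dist s t < ε) :
      (η t : Measure X).support ⊆ Metric.cthickening ε (η s : Measure X).support := by
    lift ε to ℝ≥0 using dist_nonneg.trans hst.le
    exact (hη.prokhorovLE_zero hmono hdiv htop
      (dist_comm s t ▸ hst)).support_subset_cthickening
  have hcompact (s : Icc (0 : ℝ) b) : IsCompact (η s : Measure X).support := (η s).2.1.2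
  refine ⟨fun s t => congrArg ENNReal.toReal ((hmass s t).antisymm (hmass t s)), hsupport, ?_⟩
  simpa only [biUnion_univ] using isCompact_biUnion_of_upperHemicontinuousOn isCompact_univ
    (fun s _ => hcompact s)
    (upperHemicontinuous_of_subset_cthickening hcompact hsupport |>.upperHemicontinuousOn _)

theorem mainTheorem9 {X : Type*} [MetricSpace X] [LocallyCompactSpace X]
    [TopologicalSpace.SeparableSpace X] [MeasurableSpace X] [BorelSpace X]
    (μ : Measure X) (hμ : PosFiniteOnBalls μ)
    (h : ℝ≥0 → ℝ≥0) (hh : IsMassGauge h)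
    (b : ℝ) (hb : 0 ≤ b) (η : Icc (0 : ℝ) b → subMeasures μ)
    (hη : IsSubArcLengthCurve μ h η) :
    (∀ s t : Icc (0 : ℝ) b, totalMass (η s : Measure X) = totalMass (η t : Measure X)) ∧
    (∀ (s t : Icc (0 : ℝ) b) (ε : ℝ), |(s : ℝ) - (t : ℝ)| < ε →
      (η t : Measure X).support ⊆ Metric.cthickening ε (η s : Measure X).support) ∧
    IsCompact (⋃ s : Icc (0 : ℝ) b, (η s : Measure X).support) :=
  mainTheorem9_general μ hh.strictMono.monotone hh.tendsto_div_zero hh.tendsto_atTop η hη
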